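/- Let $\varphi(r)=r^2\log r$ for $r>0$, $\varphi(0)=0$, be the thin-plate spline radial basis function, and for $j\in\mathbb{Z}$ let $$\lambda_j=\frac1{2\pi}\int_{-\pi}^{\pi}(2-2\cos\theta)^{3/2}\,e^{-ij\theta}\,d\theta$$ be the Fourier coefficients of $(2-2\cos\theta)^{3/2}$ (these are real numbers). Then for every $x\in\mathbb{R}$ the series defining the (normalised) quasi-Lagrange function $$\psi(x)=\frac1{2\pi}\sum_{j\in\mathbb{Z}}\lambda_j\,\varphi(|x-j|),\qquad x\in\mathbb{R},$$ converges absolutely, and the quasi-interpolation with $\psi$ is exact for linear polynomials: for every real polynomial $p$ of degree at most $1$ and every $x\in\mathbb{R}$, $$\sum_{k\in\mathbb{Z}}p(k)\,\psi(x-k)=p(x),$$ where the series converges absolutely. -/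

import Mathlib

open Polynomial

/-- The thin-plate spline radial basis function `φ(r) = r² log r`, with `φ(0) = 0`
(its continuous value, which is what `Real.log 0 = 0` gives). -/
noncomputable def thinPlateSpline (r : ℝ) : ℝ := r ^ 2 * Real.log r

/-- The `2π`-periodic symbol `θ ↦ (2 - 2 cos θ)^{3/2}`. -/
noncomputable def oddSymbol (θ : ℝ) : ℝ := (2 - 2 * Real.cos θ) ^ (3 / 2 : ℝ)

/-- The `j`-th coefficient `lam j`, the `j`-th Fourier coefficient
`(2π)⁻¹ ∫_{-π}^{π} e^{-ijθ} (2 - 2 cos θ)^{3/2} dθ` of the symbol. The coefficient is a real number,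
see `ofReal_lam`, so that taking the real part only changes the type. -/
noncomputable def lam (j : ℤ) : ℝ :=
  (fourierCoeffOn (neg_lt_self Real.pi_pos) (fun θ : ℝ => (oddSymbol θ : ℂ)) j).re

theorem ofReal_lam (j : ℤ) :
    (lam j : ℂ) =
      fourierCoeffOn (neg_lt_self Real.pi_pos) (fun θ : ℝ => (oddSymbol θ : ℂ)) j := by
  rw [lam, ← Complex.conj_eq_iff_re, fourierCoeffOn_eq_integral]
  rw [Complex.real_smul, map_mul, Complex.conj_ofReal]
  congr 1
  rw [← intervalIntegral.intervalIntegral_conj]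
  have h := intervalIntegral.integral_comp_neg (a := -Real.pi) (b := Real.pi)
    (fun x : ℝ => (fourier (-j) (x : AddCircle (Real.pi - -Real.pi)) : ℂ) • (oddSymbol x : ℂ))
  rw [neg_neg] at h
  rw [← h]
  refine intervalIntegral.integral_congr fun x _ => ?_
  simp [oddSymbol]

/-- The quasi-Lagrange function `ψ(x) = ∑_{j ∈ ℤ} λ_j φ(|x - j|)`, divided by `2π` so that its
Fourier transform has value `1` at the origin. -/
noncomputable def quasiLagrange (x : ℝ) : ℝ :=
  (2 * Real.pi)⁻¹ * ∑' j : ℤ, lam j * thinPlateSpline |x - j|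

/-!
The symbol `|2 sin (θ / 2)| ^ 3` vanishes to third order at the origin, so the sequence `λ`
annihilates quadratic polynomials. Writing `y² log |y|` as a regularised Fourier integral of `|ξ|⁻³`
(a Frullani integral after one subtraction), the regularising terms are therefore killed by `λ`, and
`ψ` is the Fourier transform of `G w = |sin (π w) / (π w)| ^ 3`. Since `G` is of class `C²` with a
Lipschitz second derivative, all with decay, `ψ x = O(|x|⁻³)`. Linear reproduction is then the
Strang-Fix argument: by Poisson summation, `∑ ψ (x - k) = 1` because `G` is `1` at the origin and
`0` at the other integers, and `∑ (x - k) ψ (x - k) = 0` because `G'` vanishes at every integer.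
-/

open MeasureTheory Filter Topology Asymptotics Set
open scoped FourierTransform ContDiff

/-! ### Fourier coefficients of the symbol -/

theorem oddSymbol_eq_abs_pow (θ : ℝ) : oddSymbol θ = |2 * Real.sin (θ / 2)| ^ 3 := by
  have half_angle : 2 - 2 * Real.cos θ = (2 * Real.sin (θ / 2)) ^ 2 := by
    have := Real.sin_sq_eq_half_sub (θ / 2)
    rw [mul_div_cancel₀ θ two_ne_zero] at this
    rw [mul_pow, this]
    ring
  rw [oddSymbol, half_angle, ← sq_abs, ← Real.rpow_natCast_mul (abs_nonneg _)]
  norm_num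

theorem continuous_oddSymbol : Continuous oddSymbol := by
  simp only [funext oddSymbol_eq_abs_pow]
  fun_prop

theorem periodic_oddSymbol : Function.Periodic oddSymbol (2 * Real.pi) := fun θ => by
  simp only [oddSymbol, Real.cos_add_two_pi]

theorem oddSymbol_eq_sub {θ : ℝ} (hθ : θ ∈ Icc 0 (2 * Real.pi)) :
    oddSymbol θ = 6 * Real.sin (1 / 2 * θ) - 2 * Real.sin (3 / 2 * θ) := by
  have sin_nonneg : 0 ≤ Real.sin (θ / 2) :=
    Real.sin_nonneg_of_nonneg_of_le_pi (by linarith [hθ.1]) (by linarith [hθ.2])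
  rw [oddSymbol_eq_abs_pow, abs_of_nonneg (by positivity), one_div_mul_eq_div,
    show 3 / 2 * θ = 3 * (θ / 2) by ring, Real.sin_three_mul]
  ring

theorem fourier_neg_coe_apply_two_pi (j : ℤ) {T : ℝ} (hT : T = 2 * Real.pi) (θ : ℝ) :
    fourier (-j) (θ : AddCircle T) = Complex.exp ((-(j * θ) : ℝ) * Complex.I) := by
  have : (Real.pi : ℂ) ≠ 0 := by exact_mod_cast Real.pi_ne_zero
  rw [fourier_coe_apply, hT]
  push_cast
  field_simp

theorem lam_eq_integral (j : ℤ) :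
    lam j = (2 * Real.pi)⁻¹ * ∫ θ in 0..2 * Real.pi, Real.cos (j * θ) * oddSymbol θ := by
  have two_pi : Real.pi - -Real.pi = 2 * Real.pi := by ring
  have integrand_re (θ : ℝ) :
      ((fourier (-j) (θ : AddCircle (Real.pi - -Real.pi)) : ℂ) • (oddSymbol θ : ℂ)).re =
        Real.cos (j * θ) * oddSymbol θ := by
    rw [fourier_neg_coe_apply_two_pi j two_pi, smul_eq_mul, Complex.re_mul_ofReal,
      Complex.exp_ofReal_mul_I_re, Real.cos_neg]
  have periodic : Function.Periodic (fun θ => Real.cos (j * θ) * oddSymbol θ) (2 * Real.pi) := by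
    intro θ
    simp only [periodic_oddSymbol θ, mul_add, Real.cos_add_int_mul_two_pi]
  have integrable : IntervalIntegrable
      (fun θ : ℝ => (fourier (-j) (θ : AddCircle (Real.pi - -Real.pi)) : ℂ) • (oddSymbol θ : ℂ))
      volume (-Real.pi) Real.pi := by
    have := continuous_oddSymbol
    simp only [fourier_neg_coe_apply_two_pi j two_pi]
    exact Continuous.intervalIntegrable (by fun_prop) _ _
  have shift := periodic.intervalIntegral_add_eq (-Real.pi) 0
  rw [zero_add, show -Real.pi + 2 * Real.pi = Real.pi by ring] at shift
  have re_integral := Complex.reCLM.intervalIntegral_comp_comm integrable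
  simp only [Complex.reCLM_apply, integrand_re] at re_integral
  rw [lam, fourierCoeffOn_eq_integral, Complex.real_smul, Complex.re_ofReal_mul, ← re_integral,
    shift, two_pi, one_div]

theorem integral_cos_mul_sin {a b : ℝ} (hab : a ^ 2 - b ^ 2 ≠ 0) (c : ℝ) :
    ∫ θ in 0..c, Real.cos (b * θ) * Real.sin (a * θ) =
      (a - a * Real.cos (a * c) * Real.cos (b * c) - b * Real.sin (a * c) * Real.sin (b * c)) /
        (a ^ 2 - b ^ 2) := by
  have antideriv (θ : ℝ) : HasDerivAt
      (fun θ => -(a * (Real.cos (a * θ) * Real.cos (b * θ)) +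
        b * (Real.sin (a * θ) * Real.sin (b * θ))) / (a ^ 2 - b ^ 2))
      (Real.cos (b * θ) * Real.sin (a * θ)) θ := by
    have ha : HasDerivAt (fun θ => a * θ) a θ := hasDerivAt_const_mul a
    have hb : HasDerivAt (fun θ => b * θ) b θ := hasDerivAt_const_mul b
    convert! ((((ha.cos.mul hb.cos).const_mul a).add
      ((ha.sin.mul hb.sin).const_mul b)).neg).div_const (a ^ 2 - b ^ 2) using 1
    field_simp
    ring
  rw [intervalIntegral.integral_eq_sub_of_hasDerivAt (fun θ _ => antideriv θ)
    (Continuous.intervalIntegrable (by fun_prop) _ _)]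
  simp only [mul_zero, Real.cos_zero, Real.sin_zero]
  ring

theorem sq_sub_intCast_sq_ne_zero {m : ℤ} (hm : Odd m) (j : ℤ) :
    (m / 2 : ℝ) ^ 2 - (j : ℝ) ^ 2 ≠ 0 := by
  intro h
  have : m ^ 2 = (2 * j) ^ 2 := by
    have : (m : ℝ) ^ 2 = (2 * j) ^ 2 := by linear_combination 4 * h
    exact_mod_cast this
  exact Int.not_even_iff_odd.2 (this ▸ hm.pow) ((even_two_mul j).pow_of_ne_zero two_ne_zero)

theorem integral_cos_mul_sin_half {m : ℤ} (hm : Odd m) (j : ℤ) :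
    ∫ θ in 0..2 * Real.pi, Real.cos (j * θ) * Real.sin (m / 2 * θ) =
      m / ((m / 2 : ℝ) ^ 2 - (j : ℝ) ^ 2) := by
  have cos_end : Real.cos (m / 2 * (2 * Real.pi)) = -1 := by
    rw [show (m / 2 : ℝ) * (2 * Real.pi) = m * Real.pi by ring, Real.cos_int_mul_pi,
      hm.neg_one_zpow]
  rw [integral_cos_mul_sin (sq_sub_intCast_sq_ne_zero hm j), cos_end, Real.cos_int_mul_two_pi,
    show (j : ℝ) * (2 * Real.pi) = (2 * j : ℤ) * Real.pi by push_cast; ring, Real.sin_int_mul_pi]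
  ring

theorem lam_eq (j : ℤ) :
    lam j = 6 / Real.pi * (((j : ℝ) ^ 2 - 1 / 4)⁻¹ * ((j : ℝ) ^ 2 - 9 / 4)⁻¹) := by
  have ne_one := sq_sub_intCast_sq_ne_zero (m := 1) (by decide) j
  have ne_three := sq_sub_intCast_sq_ne_zero (m := 3) (by decide) j
  have integral_one := integral_cos_mul_sin_half (m := 1) (by decide) j
  have integral_three := integral_cos_mul_sin_half (m := 3) (by decide) j
  push_cast at ne_one ne_three integral_one integral_three
  have integral_oddSymbol : ∫ θ in 0..2 * Real.pi, Real.cos (j * θ) * oddSymbol θ =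
      6 * (1 / ((1 / 2 : ℝ) ^ 2 - (j : ℝ) ^ 2)) - 2 * (3 / ((3 / 2 : ℝ) ^ 2 - (j : ℝ) ^ 2)) := by
    rw [← integral_one, ← integral_three, ← intervalIntegral.integral_const_mul,
      ← intervalIntegral.integral_const_mul, ← intervalIntegral.integral_sub
        (Continuous.intervalIntegrable (by fun_prop) _ _)
        (Continuous.intervalIntegrable (by fun_prop) _ _)]
    refine intervalIntegral.integral_congr fun θ hθ => ?_
    rw [uIcc_of_le Real.two_pi_pos.le] at hθ
    simp only [oddSymbol_eq_sub hθ]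
    ring
  have ne_one' : (j : ℝ) ^ 2 - 1 / 4 ≠ 0 := fun h => ne_one (by linear_combination -h)
  have ne_three' : (j : ℝ) ^ 2 - 9 / 4 ≠ 0 := fun h => ne_three (by linear_combination -h)
  rw [lam_eq_integral, integral_oddSymbol,
    show (1 / 2 : ℝ) ^ 2 - (j : ℝ) ^ 2 = -((j : ℝ) ^ 2 - 1 / 4) by ring,
    show (3 / 2 : ℝ) ^ 2 - (j : ℝ) ^ 2 = -((j : ℝ) ^ 2 - 9 / 4) by ring]
  generalize hA : (j : ℝ) ^ 2 - 1 / 4 = A at *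
  generalize hB : (j : ℝ) ^ 2 - 9 / 4 = B at *
  obtain rfl : B = A - 2 := by linarith
  have := Real.pi_ne_zero
  field_simp
  ring

theorem isBigO_inv_sq_sub (c : ℝ) :
    (fun x : ℝ => (x ^ 2 - c)⁻¹) =O[cocompact ℝ] fun x => |x| ^ (-2 : ℝ) := by
  have sq_tendsto : Tendsto (fun x : ℝ => |x| ^ 2) (cocompact ℝ) atTop :=
    (tendsto_pow_atTop two_ne_zero).comp tendsto_norm_cocompact_atTop
  refine IsBigO.of_bound 2 ?_
  filter_upwards [sq_tendsto.eventually_gt_atTop (max 0 (2 * c))] with x hx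
  obtain ⟨sq_pos, hxc⟩ := max_lt_iff.1 hx
  rw [sq_abs] at sq_pos hxc
  rw [Real.rpow_neg (abs_nonneg x), Real.rpow_two, sq_abs,
    Real.norm_of_nonneg (inv_nonneg.2 (by linarith)), Real.norm_of_nonneg (by positivity)]
  calc (x ^ 2 - c)⁻¹ ≤ (x ^ 2 / 2)⁻¹ := inv_anti₀ (by positivity) (by linarith)
    _ = 2 * (x ^ 2)⁻¹ := by rw [inv_div, div_eq_mul_inv]

theorem isBigO_lam : lam =O[cofinite] fun j : ℤ => |(j : ℝ)| ^ (-4 : ℝ) := by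
  have decay := (isBigO_inv_sq_sub (1 / 4)).mul (isBigO_inv_sq_sub (9 / 4))
  simp only [← Real.rpow_add' (abs_nonneg _) (show (-2 + -2 : ℝ) ≠ 0 by norm_num),
    show (-2 + -2 : ℝ) = -4 by norm_num] at decay
  simpa only [← lam_eq, Function.comp_def] using
    (decay.const_mul_left (6 / Real.pi)).comp_tendsto Int.tendsto_coe_cofinite

theorem summable_lam_mul {f : ℤ → ℝ} {p : ℝ} (hp : p < 3)
    (hf : f =O[cofinite] fun j => |(j : ℝ)| ^ p) : Summable fun j => lam j * f j := by
  refine summable_of_isBigO (Real.summable_abs_int_rpow (b := 4 - p) (by linarith))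
    ((isBigO_lam.mul hf).congr' .rfl ?_)
  filter_upwards [(Set.finite_singleton (0 : ℤ)).compl_mem_cofinite] with j hj
  rw [← Real.rpow_add (abs_pos.2 (Int.cast_ne_zero.2 hj))]
  ring_nf

theorem isBigO_abs_sub_intCast_rpow (x : ℝ) {p : ℝ} (hp : 0 ≤ p) :
    (fun j : ℤ => |x - j| ^ p) =O[cofinite] fun j => |(j : ℝ)| ^ p := by
  have const : (fun _ : ℤ => x) =O[cofinite] fun j => (j : ℝ) :=
    (isLittleO_const_left.2 (.inr (tendsto_norm_cocompact_atTop.comp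
      Int.tendsto_coe_cofinite))).isBigO
  exact ((const.sub (isBigO_refl _ _)).norm_norm).rpow hp (.of_forall fun _ => abs_nonneg _)

theorem hasSum_fourierCoeffOn_of_summable {a b : ℝ} (hab : a < b) {f : ℝ → ℂ} (hf : Continuous f)
    (hper : Function.Periodic f (b - a)) (hsum : Summable (fourierCoeffOn hab f)) (x : ℝ) :
    HasSum (fun n => fourierCoeffOn hab f n * fourier n (x : AddCircle (b - a))) (f x) := by
  have : Fact (0 < b - a) := ⟨sub_pos.2 hab⟩
  let lift : C(AddCircle (b - a), ℂ) := ⟨hper.lift, continuous_coinduced_dom.2 hf⟩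
  have coeff_lift (n : ℤ) : fourierCoeff lift n = fourierCoeffOn hab f n := by
    rw [fourierCoeffOn_eq_integral, fourierCoeff_eq_intervalIntegral _ _ a, add_sub_cancel]
    rfl
  have := has_pointwise_sum_fourier_series_of_summable (f := lift)
    (hsum.congr fun n => (coeff_lift n).symm) x
  simpa only [coeff_lift, smul_eq_mul] using! this

theorem summable_lam : Summable lam := by
  simpa using summable_lam_mul (f := fun _ => 1) (p := 0) three_pos
    (by simpa using isBigO_refl (fun _ : ℤ => (1 : ℝ)) cofinite)

theorem hasSum_lam_mul_exp (ξ : ℝ) :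
    HasSum (fun j : ℤ => (lam j : ℂ) * Complex.exp ((j * ξ : ℝ) * Complex.I)) (oddSymbol ξ) := by
  have periodic : Function.Periodic (fun θ => (oddSymbol θ : ℂ)) (Real.pi - -Real.pi) := fun θ => by
    simp only [sub_neg_eq_add, ← two_mul, periodic_oddSymbol θ]
  have series := hasSum_fourierCoeffOn_of_summable (neg_lt_self Real.pi_pos)
    (Complex.continuous_ofReal.comp continuous_oddSymbol) periodic
    (by simpa only [ofReal_lam] using! Complex.summable_ofReal.2 summable_lam) ξ
  simp only [Function.comp_def, ← ofReal_lam] at series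
  refine series.congr_fun fun j => ?_
  have := fourier_neg_coe_apply_two_pi (-j) (show Real.pi - -Real.pi = 2 * Real.pi by ring) ξ
  simp only [neg_neg, Int.cast_neg, neg_mul] at this
  rw [this]

theorem hasSum_lam_mul_cos (x ξ : ℝ) :
    HasSum (fun j : ℤ => lam j * Real.cos (ξ * (x - j))) (Real.cos (ξ * x) * oddSymbol ξ) := by
  have h := Complex.hasSum_re
    ((hasSum_lam_mul_exp ξ).mul_left (Complex.exp ((-(ξ * x) : ℝ) * Complex.I)))
  convert! h using 1
  · funext j
    rw [mul_left_comm, ← Complex.exp_add, ← add_mul, ← Complex.ofReal_add, Complex.re_ofReal_mul,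
      Complex.exp_ofReal_mul_I_re, ← Real.cos_neg]
    ring_nf
  · rw [Complex.re_mul_ofReal, Complex.exp_ofReal_mul_I_re, Real.cos_neg]

theorem cos_sub_one_eq_sinc (t : ℝ) : Real.cos t - 1 = -(t ^ 2 / 2) * Real.sinc (t / 2) ^ 2 := by
  rcases eq_or_ne t 0 with rfl | ht
  · simp
  · rw [Real.sinc_of_ne_zero (by positivity), div_pow, Real.sin_sq_eq_half_sub,
      mul_div_cancel₀ t two_ne_zero]
    field_simp
    ring

theorem hasSum_mul_sq_zero_of_isLittleO {ι : Type*} {a y : ι → ℝ} {F : ℝ → ℝ}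
    (hsum : Summable fun i => a i * y i ^ 2)
    (hF : ∀ ξ, HasSum (fun i => a i * Real.cos (ξ * y i)) (F ξ)) (hF0 : F =o[𝓝 0] fun ξ => ξ ^ 2) :
    HasSum (fun i => a i * y i ^ 2) 0 := by
  have F_zero : F 0 = 0 := by simpa using hF0.isBigO.eq_zero_imp.self_of_nhds
  have second_difference (ξ : ℝ) (hξ : ξ ≠ 0) :
      ∑' i, a i * y i ^ 2 * Real.sinc (ξ * y i / 2) ^ 2 = -2 * (F ξ / ξ ^ 2) := by
    have := (((hF ξ).sub (hF 0)).mul_left (-2 / ξ ^ 2)).tsum_eq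
    rw [F_zero, sub_zero] at this
    rw [← mul_div_assoc, ← div_mul_eq_mul_div, ← this]
    refine tsum_congr fun i => ?_
    rw [zero_mul, Real.cos_zero, ← mul_sub, cos_sub_one_eq_sinc]
    field_simp
  have lim_sinc : Tendsto (fun ξ => ∑' i, a i * y i ^ 2 * Real.sinc (ξ * y i / 2) ^ 2) (𝓝[≠] 0)
      (𝓝 (∑' i, a i * y i ^ 2)) := by
    refine tendsto_tsum_of_dominated_convergence hsum.norm (fun i => ?_) (.of_forall fun ξ i => ?_)
    · have : Continuous fun ξ => a i * y i ^ 2 * Real.sinc (ξ * y i / 2) ^ 2 := by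
        have := Real.continuous_sinc
        fun_prop
      simpa using (this.tendsto 0).mono_left nhdsWithin_le_nhds
    · rw [norm_mul]
      refine mul_le_of_le_one_right (norm_nonneg _) ?_
      rw [norm_pow]
      exact pow_le_one₀ (norm_nonneg _) (Real.abs_sinc_le_one _)
  have lim_F : Tendsto (fun ξ => -2 * (F ξ / ξ ^ 2)) (𝓝[≠] 0) (𝓝 0) := by
    simpa using (hF0.tendsto_div_nhds_zero.mono_left nhdsWithin_le_nhds).const_mul (-2)
  have tsum_zero : ∑' i, a i * y i ^ 2 = 0 := tendsto_nhds_unique lim_sinc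
    (lim_F.congr' (eventually_mem_nhdsWithin.mono fun ξ hξ => (second_difference ξ hξ).symm))
  exact tsum_zero ▸ hsum.hasSum

theorem oddSymbol_eq_abs_mul_sinc (ξ : ℝ) : oddSymbol ξ = |ξ * Real.sinc (ξ / 2)| ^ 3 := by
  rcases eq_or_ne ξ 0 with rfl | hξ
  · simp [oddSymbol_eq_abs_pow]
  · rw [oddSymbol_eq_abs_pow, Real.sinc_of_ne_zero (by positivity)]
    field_simp

theorem isLittleO_oddSymbol : oddSymbol =o[𝓝 0] fun ξ => ξ ^ 2 := by
  refine IsBigO.trans_isLittleO (g := fun ξ => ξ ^ 3) (.of_bound 1 (.of_forall fun ξ => ?_))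
    (isLittleO_pow_pow (by norm_num))
  rw [oddSymbol_eq_abs_mul_sinc, one_mul, norm_pow, norm_pow, Real.norm_eq_abs, abs_abs, abs_mul]
  gcongr
  exact mul_le_of_le_one_right (abs_nonneg _) (Real.abs_sinc_le_one _)

theorem hasSum_lam : HasSum lam 0 := by
  simpa [oddSymbol_eq_abs_pow] using hasSum_lam_mul_cos 0 0

theorem hasSum_lam_mul_sub_sq (x : ℝ) : HasSum (fun j : ℤ => lam j * (x - j) ^ 2) 0 := by
  refine hasSum_mul_sq_zero_of_isLittleO ?_ (hasSum_lam_mul_cos x) ?_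
  · refine summable_lam_mul (p := 2) (by norm_num) ?_
    simpa using isBigO_abs_sub_intCast_rpow x two_pos.le
  · refine IsBigO.trans_isLittleO (.of_bound 1 (.of_forall fun ξ => ?_)) isLittleO_oddSymbol
    rw [norm_mul, one_mul]
    exact mul_le_of_le_one_left (norm_nonneg _) (Real.abs_cos_le_one _)

/-! ### Integral representation of the thin-plate spline -/

/-- The integrand of `y² log |y| = 2 ∫_{ξ > 0} tpsKernel y ξ dξ`. The distributional Fourier
transform of the thin-plate spline is a multiple of `|ξ|⁻³`, and `-1 - y² (cos ξ - 1)` is the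
regularisation that makes `cos (ξ y) |ξ|⁻³` integrable at the origin. -/
noncomputable def tpsKernel (y ξ : ℝ) : ℝ :=
  (Real.cos (ξ * y) - 1 - y ^ 2 * (Real.cos ξ - 1)) / ξ ^ 3

theorem continuousOn_tpsKernel (y : ℝ) : ContinuousOn (tpsKernel y) (Ioi 0) := by
  refine ContinuousOn.div (by fun_prop) (by fun_prop) fun ξ hξ => ?_
  exact pow_ne_zero 3 (mem_Ioi.1 hξ).ne'

theorem tpsKernel_eq_sinc (y : ℝ) {ξ : ℝ} (hξ : 0 < ξ) :
    tpsKernel y ξ =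
      -(y ^ 2 / 2) * (ξ⁻¹ * (Real.sinc (|y| * ξ / 2) ^ 2 - Real.sinc (1 * ξ / 2) ^ 2)) := by
  have cos_eq : Real.cos (ξ * y) = Real.cos (|y| * ξ) := by
    rw [← Real.cos_abs, abs_mul, abs_of_pos hξ, mul_comm]
  rw [tpsKernel, cos_eq, cos_sub_one_eq_sinc, cos_sub_one_eq_sinc, mul_pow, sq_abs, one_mul]
  field_simp
  ring

theorem abs_cos_sub_one_add_sq_le (t : ℝ) :
    |Real.cos t - 1 + t ^ 2 / 2| ≤ |t| ^ (5 / 2 : ℝ) := by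
  rcases le_total |t| 1 with ht | ht
  · calc |Real.cos t - 1 + t ^ 2 / 2| = |Real.cos t - (1 - t ^ 2 / 2)| := by ring_nf
      _ ≤ |t| ^ 4 * (5 / 96) := Real.cos_bound ht
      _ ≤ |t| ^ (4 : ℝ) := by
        rw [← Real.rpow_natCast]
        exact mul_le_of_le_one_right (by positivity) (by norm_num)
      _ ≤ |t| ^ (5 / 2 : ℝ) :=
        Real.rpow_le_rpow_of_exponent_ge_of_imp (abs_nonneg t) ht (by norm_num) (by norm_num)
  · calc |Real.cos t - 1 + t ^ 2 / 2| ≤ |t| ^ (2 : ℝ) := by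
          rw [Real.rpow_two, sq_abs, abs_le]
          constructor <;>
            linarith [Real.one_sub_sq_div_two_le_cos (x := t), Real.cos_le_one t, sq_nonneg t]
      _ ≤ |t| ^ (5 / 2 : ℝ) := Real.rpow_le_rpow_of_exponent_le ht (by norm_num)

theorem abs_tpsKernel_le_rpow_neg_half (y : ℝ) {ξ : ℝ} (hξ : 0 < ξ) :
    |tpsKernel y ξ| ≤ (|y| ^ (5 / 2 : ℝ) + y ^ 2) * ξ ^ (-(1 / 2) : ℝ) := by
  have taylor_y := abs_cos_sub_one_add_sq_le (ξ * y)
  have taylor_one := abs_cos_sub_one_add_sq_le ξ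
  rw [abs_mul, Real.mul_rpow (abs_nonneg _) (abs_nonneg _), abs_of_pos hξ] at taylor_y
  rw [abs_of_pos hξ] at taylor_one
  have exponent : ξ ^ (-(1 / 2) : ℝ) = ξ ^ (5 / 2 : ℝ) / ξ ^ 3 := by
    rw [← Real.rpow_natCast, ← Real.rpow_sub hξ]
    norm_num
  rw [tpsKernel, abs_div, abs_of_pos (pow_pos hξ 3), exponent, mul_div_assoc']
  gcongr
  calc |Real.cos (ξ * y) - 1 - y ^ 2 * (Real.cos ξ - 1)|
      = |(Real.cos (ξ * y) - 1 + (ξ * y) ^ 2 / 2) - y ^ 2 * (Real.cos ξ - 1 + ξ ^ 2 / 2)| := by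
        ring_nf
    _ ≤ |Real.cos (ξ * y) - 1 + (ξ * y) ^ 2 / 2| + |y ^ 2 * (Real.cos ξ - 1 + ξ ^ 2 / 2)| :=
        abs_sub _ _
    _ ≤ ξ ^ (5 / 2 : ℝ) * |y| ^ (5 / 2 : ℝ) + y ^ 2 * ξ ^ (5 / 2 : ℝ) := by
        rw [abs_mul (y ^ 2), abs_of_nonneg (sq_nonneg y)]
        gcongr
    _ = (|y| ^ (5 / 2 : ℝ) + y ^ 2) * ξ ^ (5 / 2 : ℝ) := by ring

theorem abs_tpsKernel_le_rpow_neg_three (y : ℝ) {ξ : ℝ} (hξ : 0 < ξ) :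
    |tpsKernel y ξ| ≤ (2 + 2 * y ^ 2) * ξ ^ (-3 : ℝ) := by
  have abs_cos_sub_one_le (t : ℝ) : |Real.cos t - 1| ≤ 2 := by
    rw [abs_le]
    constructor <;> linarith [Real.cos_le_one t, Real.neg_one_le_cos t]
  rw [tpsKernel, abs_div, abs_of_pos (pow_pos hξ 3), Real.rpow_neg hξ.le, ← div_eq_mul_inv]
  norm_cast
  gcongr
  calc |Real.cos (ξ * y) - 1 - y ^ 2 * (Real.cos ξ - 1)|
      ≤ |Real.cos (ξ * y) - 1| + |y ^ 2 * (Real.cos ξ - 1)| := abs_sub _ _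
    _ ≤ 2 + y ^ 2 * 2 := by
        rw [abs_mul, abs_of_nonneg (sq_nonneg y)]
        gcongr <;> exact abs_cos_sub_one_le _
    _ = 2 + 2 * y ^ 2 := by ring

theorem abs_tpsKernel_le (y : ℝ) {ξ : ℝ} (hξ : 0 < ξ) :
    |tpsKernel y ξ| ≤
      4 * (1 + |y| ^ (5 / 2 : ℝ)) * min (ξ ^ (-(1 / 2) : ℝ)) (ξ ^ (-3 : ℝ)) := by
  have sq_le : y ^ 2 ≤ 1 + |y| ^ (5 / 2 : ℝ) := by
    rw [← sq_abs, ← Real.rpow_two]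
    rcases le_total |y| 1 with hy | hy
    · linarith [Real.rpow_le_one (abs_nonneg y) hy zero_le_two,
        Real.rpow_nonneg (abs_nonneg y) (5 / 2)]
    · linarith [Real.rpow_le_rpow_of_exponent_le hy (show (2 : ℝ) ≤ 5 / 2 by norm_num)]
  have rpow_nonneg : 0 ≤ |y| ^ (5 / 2 : ℝ) := by positivity
  rw [mul_min_of_nonneg _ _ (by positivity), le_min_iff]
  constructor
  · refine (abs_tpsKernel_le_rpow_neg_half y hξ).trans ?_
    gcongr
    linarith
  · refine (abs_tpsKernel_le_rpow_neg_three y hξ).trans ?_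
    gcongr
    linarith

theorem integrableOn_Ioi_min_rpow {a b : ℝ} (ha : -1 < a) (hb : b < -1) :
    IntegrableOn (fun ξ : ℝ => min (ξ ^ a) (ξ ^ b)) (Ioi 0) := by
  have measurable : Measurable fun ξ : ℝ => min (ξ ^ a) (ξ ^ b) := by fun_prop
  have norm_le {ξ : ℝ} (hξ : 0 < ξ) :
      ‖min (ξ ^ a) (ξ ^ b)‖ ≤ ξ ^ a ∧ ‖min (ξ ^ a) (ξ ^ b)‖ ≤ ξ ^ b := by
    rw [Real.norm_of_nonneg (by positivity)]
    exact ⟨min_le_left _ _, min_le_right _ _⟩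
  have near_zero : IntegrableOn (fun ξ : ℝ => ξ ^ a) (Ioc 0 1) :=
    (intervalIntegrable_iff_integrableOn_Ioc_of_le zero_le_one).1
      (intervalIntegral.intervalIntegrable_rpow' ha)
  have near_top : IntegrableOn (fun ξ : ℝ => ξ ^ b) (Ioi 1) :=
    integrableOn_Ioi_rpow_of_lt hb one_pos
  rw [← Ioc_union_Ioi_eq_Ioi zero_le_one]
  exact IntegrableOn.union
    (near_zero.mono' measurable.aestronglyMeasurable
      (ae_restrict_of_forall_mem measurableSet_Ioc fun ξ hξ => (norm_le hξ.1).1))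
    (near_top.mono' measurable.aestronglyMeasurable
      (ae_restrict_of_forall_mem measurableSet_Ioi fun ξ hξ => (norm_le (one_pos.trans hξ)).2))

theorem integrableOn_tpsKernel (y : ℝ) : IntegrableOn (tpsKernel y) (Ioi 0) :=
  ((integrableOn_Ioi_min_rpow (by norm_num) (by norm_num)).const_mul _).mono'
    ((continuousOn_tpsKernel y).aestronglyMeasurable measurableSet_Ioi)
    (ae_restrict_of_forall_mem measurableSet_Ioi fun _ hξ => abs_tpsKernel_le y hξ)

theorem tendsto_sinc_atTop : Tendsto Real.sinc atTop (𝓝 0) := by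
  refine squeeze_zero_norm' ?_ tendsto_inv_atTop_zero
  filter_upwards [eventually_gt_atTop 0] with t ht
  rw [Real.sinc_of_ne_zero ht.ne', norm_div, Real.norm_of_nonneg ht.le, div_eq_mul_inv]
  exact mul_le_of_le_one_left (inv_nonneg.2 ht.le) (Real.abs_sin_le_one t)

theorem thinPlateSpline_abs_eq_integral (y : ℝ) :
    thinPlateSpline |y| = 2 * ∫ ξ in Ioi 0, tpsKernel y ξ := by
  rcases eq_or_ne y 0 with rfl | hy
  · simp [thinPlateSpline, tpsKernel]
  let f (t : ℝ) : ℝ := Real.sinc (t / 2) ^ 2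
  have f_continuous : Continuous f := (Real.continuous_sinc.comp (by fun_prop)).pow 2
  have f_zero : Tendsto f (𝓝[>] 0) (𝓝 1) := by
    simpa [f] using (f_continuous.tendsto 0).mono_left nhdsWithin_le_nhds
  have f_top : Tendsto f atTop (𝓝 0) := by
    simpa [f] using (tendsto_sinc_atTop.comp (tendsto_id.atTop_div_const two_pos)).pow 2
  have kernel_eq : EqOn (tpsKernel y)
      (fun ξ => -(y ^ 2 / 2) * ξ⁻¹ • (f (|y| * ξ) - f (1 * ξ))) (Ioi 0) :=
    fun ξ hξ => tpsKernel_eq_sinc y hξ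
  have integrable : IntegrableOn (fun ξ => ξ⁻¹ • (f (|y| * ξ) - f (1 * ξ))) (Ioi 0) := by
    have := (integrableOn_congr_fun kernel_eq measurableSet_Ioi).1 (integrableOn_tpsKernel y)
    exact (integrable_const_mul_iff (isUnit_iff_ne_zero.2 (by simpa using hy)) _).1 this
  have frullani := Frullani.integral_Ioi_eq (f_continuous.locallyIntegrable.locallyIntegrableOn _)
    (abs_pos.2 hy) one_pos f_zero f_top integrable
  rw [setIntegral_congr_fun measurableSet_Ioi kernel_eq, integral_const_mul, frullani, one_div,
    Real.log_inv, thinPlateSpline, sq_abs, smul_eq_mul]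
  ring

theorem hasSum_lam_mul_tpsKernel (x ξ : ℝ) :
    HasSum (fun j : ℤ => lam j * tpsKernel (x - j) ξ) (Real.cos (ξ * x) * oddSymbol ξ / ξ ^ 3) := by
  have := (((hasSum_lam_mul_cos x ξ).sub hasSum_lam).sub
    ((hasSum_lam_mul_sub_sq x).mul_right (Real.cos ξ - 1))).div_const (ξ ^ 3)
  rw [zero_mul, sub_zero, sub_zero] at this
  refine this.congr_fun fun j => ?_
  rw [tpsKernel]
  ring

theorem hasSum_lam_mul_thinPlateSpline (x : ℝ) :
    HasSum (fun j : ℤ => lam j * thinPlateSpline |x - j|)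
      (2 * ∫ ξ in Ioi 0, Real.cos (ξ * x) * oddSymbol ξ / ξ ^ 3) := by
  have summable_bound : Summable fun j : ℤ => |lam j| * (4 * (1 + |x - j| ^ (5 / 2 : ℝ))) := by
    have := (summable_lam_mul (by norm_num) (isBigO_abs_sub_intCast_rpow x
      (show (0 : ℝ) ≤ 5 / 2 by norm_num))).abs
    refine ((summable_lam.abs.add this).mul_left 4).congr fun j => ?_
    rw [abs_mul, abs_of_nonneg (Real.rpow_nonneg (abs_nonneg (x - j)) _)]
    ring
  let majorant (ξ : ℝ) : ℝ := min (ξ ^ (-(1 / 2) : ℝ)) (ξ ^ (-3 : ℝ))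
  have interchange := hasSum_integral_of_dominated_convergence (μ := volume.restrict (Ioi 0))
    (F := fun (j : ℤ) ξ => lam j * tpsKernel (x - j) ξ)
    (fun j ξ => |lam j| * (4 * (1 + |x - j| ^ (5 / 2 : ℝ))) * majorant ξ)
    (fun j => (integrableOn_tpsKernel _).aestronglyMeasurable.const_mul _)
    (fun j => ae_restrict_of_forall_mem measurableSet_Ioi fun ξ hξ => by
      rw [norm_mul, mul_assoc]
      exact mul_le_mul_of_nonneg_left (abs_tpsKernel_le _ hξ) (norm_nonneg _))
    (.of_forall fun ξ => summable_bound.mul_right _)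
    (by
      simp only [tsum_mul_right]
      exact (integrableOn_Ioi_min_rpow (by norm_num) (by norm_num)).const_mul _)
    (.of_forall fun ξ => hasSum_lam_mul_tpsKernel x ξ)
  refine (interchange.mul_left 2).congr_fun fun j => ?_
  rw [thinPlateSpline_abs_eq_integral, integral_const_mul]
  ring

theorem quasiLagrange_eq_integral (x : ℝ) :
    quasiLagrange x = Real.pi⁻¹ * ∫ ξ in Ioi 0, Real.cos (ξ * x) * oddSymbol ξ / ξ ^ 3 := by
  rw [quasiLagrange, (hasSum_lam_mul_thinPlateSpline x).tsum_eq, mul_inv]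
  ring

/-! ### Decay of Fourier transforms -/

/-- The weight `(1 + |w|)⁻¹`, against whose powers the decay of functions on the line is
measured. -/
noncomputable def decayWeight (w : ℝ) : ℝ := (1 + |w|)⁻¹

theorem decayWeight_pos (w : ℝ) : 0 < decayWeight w := by
  unfold decayWeight
  positivity

theorem decayWeight_le_one (w : ℝ) : decayWeight w ≤ 1 :=
  inv_le_one_of_one_le₀ (le_add_of_nonneg_right (abs_nonneg w))

theorem decayWeight_le_two_mul {u w : ℝ} (h : |u - w| ≤ 1) :
    decayWeight u ≤ 2 * decayWeight w := by
  have := abs_sub_abs_le_abs_sub w u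
  rw [abs_sub_comm] at this
  calc decayWeight u ≤ ((1 + |w|) / 2)⁻¹ :=
        inv_anti₀ (by positivity) (by linarith [abs_nonneg u])
    _ = 2 * decayWeight w := by rw [inv_div, div_eq_mul_inv, decayWeight]

theorem integrable_decayWeight_pow {n : ℕ} (hn : 2 ≤ n) :
    Integrable fun w => decayWeight w ^ n := by
  have one_lt : (1 : ℝ) < n := by exact_mod_cast hn
  refine (integrable_one_add_norm (E := ℝ) (μ := volume) (r := n) (by simpa using one_lt)).congr
    (.of_forall fun w => ?_)
  simp only [decayWeight, inv_pow, Real.norm_eq_abs]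
  rw [Real.rpow_neg (by positivity), Real.rpow_natCast]

section Increments

variable {E : Type*} [NormedAddCommGroup E]

theorem integrable_of_isBigO_decayWeight_pow {f : ℝ → E} {n : ℕ} (hn : 2 ≤ n) (hf : Continuous f)
    (hO : f =O[⊤] fun w => decayWeight w ^ n) : Integrable f :=
  hO.integrable hf.aestronglyMeasurable (integrable_decayWeight_pow hn)

/-- The increments of `f` over steps of length at most `1` are bounded by the length of the step
times the `n`-th power of `decayWeight`: a Lipschitz condition with a decaying constant. -/
def HasDecayingIncrements (f : ℝ → E) (n : ℕ) : Prop :=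
  (fun p : ℝ × ℝ => f (p.1 + p.2) - f p.1) =O[𝓟 {p | |p.2| ≤ 1}] fun p => decayWeight p.1 ^ n * p.2

theorem HasDecayingIncrements.exists_norm_sub_le {f : ℝ → E} {n : ℕ}
    (hf : HasDecayingIncrements f n) :
    ∃ C, ∀ w h, |h| ≤ 1 → ‖f (w + h) - f w‖ ≤ C * |h| * decayWeight w ^ n := by
  obtain ⟨C, hC⟩ := hf.bound
  refine ⟨C, fun w h hh => (eventually_principal.1 hC (w, h) hh).trans_eq ?_⟩
  rw [norm_mul, norm_pow, Real.norm_of_nonneg (decayWeight_pos w).le, Real.norm_eq_abs]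
  ring

theorem HasDecayingIncrements.of_hasDerivAt [NormedSpace ℝ E] {f f' : ℝ → E} {n : ℕ}
    (hf : ∀ w, HasDerivAt f (f' w) w) (hf' : f' =O[⊤] fun w => decayWeight w ^ n) :
    HasDecayingIncrements f n := by
  obtain ⟨C, hC⟩ := hf'.bound
  refine .of_bound (|C| * 2 ^ n) (eventually_principal.2 ?_)
  rintro ⟨w, h⟩ (hh : |h| ≤ 1)
  have derivative_le (u : ℝ) (hu : u ∈ Metric.closedBall w 1) :
      ‖f' u‖ ≤ |C| * 2 ^ n * decayWeight w ^ n := by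
    have weight_nonneg := (decayWeight_pos u).le
    calc ‖f' u‖ ≤ C * decayWeight u ^ n := by
          simpa [abs_of_nonneg weight_nonneg] using eventually_top.1 hC u
      _ ≤ |C| * (2 * decayWeight w) ^ n := by
          gcongr
          · exact le_abs_self C
          · exact decayWeight_le_two_mul hu
      _ = |C| * 2 ^ n * decayWeight w ^ n := by ring
  have mean_value := (convex_closedBall w 1).norm_image_sub_le_of_norm_hasDerivWithin_le
    (fun u _ => (hf u).hasDerivWithinAt) derivative_le (x := w) (y := w + h) (by simp)
    (by simpa [Real.dist_eq] using hh)
  rwa [add_sub_cancel_left, mul_assoc, ← Real.norm_of_nonneg (pow_nonneg (decayWeight_pos w).le n),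
    ← norm_mul] at mean_value

theorem HasDecayingIncrements.norm {f : ℝ → E} {n : ℕ} (hf : HasDecayingIncrements f n) :
    HasDecayingIncrements (fun w => ‖f w‖) n :=
  IsBigO.trans (.of_bound 1 (.of_forall fun p => by
    simpa using abs_norm_sub_norm_le (f (p.1 + p.2)) (f p.1))) hf

theorem HasDecayingIncrements.ofReal {f : ℝ → ℝ} {n : ℕ} (hf : HasDecayingIncrements f n) :
    HasDecayingIncrements (fun w => (f w : ℂ)) n :=
  IsBigO.trans (.of_bound 1 (.of_forall fun p => by
    rw [← Complex.ofReal_sub, Complex.norm_real, one_mul])) hf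

theorem isBigO_comp_add_decayWeight_pow {f : ℝ → E} {n : ℕ}
    (hf : f =O[⊤] fun w => decayWeight w ^ n) :
    (fun p : ℝ × ℝ => f (p.1 + p.2)) =O[𝓟 {p | |p.2| ≤ 1}] fun p => decayWeight p.1 ^ n := by
  have weight : (fun p : ℝ × ℝ => decayWeight (p.1 + p.2)) =O[𝓟 {p | |p.2| ≤ 1}]
      fun p => decayWeight p.1 := by
    refine .of_bound 2 (eventually_principal.2 fun p (hp : |p.2| ≤ 1) => ?_)
    rw [Real.norm_of_nonneg (decayWeight_pos _).le, Real.norm_of_nonneg (decayWeight_pos _).le]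
    exact decayWeight_le_two_mul (by rwa [add_sub_cancel_left])
  exact (hf.comp_tendsto tendsto_top).trans (weight.pow n)

theorem HasDecayingIncrements.mul {R : Type*} [NormedRing R] {f g : ℝ → R} {m n : ℕ}
    (hf : HasDecayingIncrements f m) (hg : HasDecayingIncrements g n)
    (hfO : f =O[⊤] fun w => decayWeight w ^ m) (hgO : g =O[⊤] fun w => decayWeight w ^ n) :
    HasDecayingIncrements (fun w => f w * g w) (m + n) := by
  have g_fst : (fun p : ℝ × ℝ => g p.1) =O[𝓟 {p | |p.2| ≤ 1}] fun p => decayWeight p.1 ^ n :=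
    hgO.comp_tendsto tendsto_top
  have increment_f := (IsBigO.mul hf g_fst).congr_right fun p =>
    show _ = decayWeight p.1 ^ (m + n) * p.2 by ring
  have increment_g := ((isBigO_comp_add_decayWeight_pow hfO).mul hg).congr_right fun p =>
    show _ = decayWeight p.1 ^ (m + n) * p.2 by ring
  refine (increment_f.add increment_g).congr_left fun p => ?_
  noncomm_ring

end Increments

section FourierDecay

variable {E : Type*} [NormedAddCommGroup E] [NormedSpace ℂ E]

theorem HasDecayingIncrements.isBigO_fourier {f : ℝ → E} {n : ℕ}
    (hinc : HasDecayingIncrements f n) (hn : 2 ≤ n) (hf : Integrable f) :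
    𝓕 f =O[cocompact ℝ] fun x => |x| ^ (-1 : ℝ) := by
  obtain ⟨C, hC⟩ := hinc.exists_norm_sub_le
  refine .of_bound (∫ w, C * decayWeight w ^ n) ?_
  filter_upwards [(tendsto_norm_cocompact_atTop (E := ℝ)).eventually_ge_atTop 1] with x hx
  have x_ne_zero : x ≠ 0 := norm_pos_iff.1 (one_pos.trans_le hx)
  -- Translating by half a period of the character `w ↦ e^{-2πiwx}` changes its sign.
  rw [Real.fourier_eq, fourierIntegral_eq_half_sub_half_period_translate x_ne_zero hf]
  set h : ℝ := (1 / (2 * ‖x‖ ^ 2) : ℝ) • x with h_def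
  have abs_h : |h| = 1 / 2 * |x|⁻¹ := by
    rw [h_def, smul_eq_mul, abs_mul, abs_of_pos (by positivity), Real.norm_eq_abs]
    field_simp
  have inv_le_one : |x|⁻¹ ≤ 1 := inv_le_one_of_one_le₀ hx
  have integrand_le (w : ℝ) : ‖Real.fourierChar (-inner ℝ w x) • (f w - f (w + h))‖ ≤
      |h| * (C * decayWeight w ^ n) := by
    rw [Circle.norm_smul, norm_sub_rev]
    exact (hC w h (by linarith)).trans_eq (by ring)
  have integral_le := norm_integral_le_of_norm_le
    (((integrable_decayWeight_pow hn).const_mul C).const_mul |h|) (.of_forall integrand_le)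
  have half_le : ‖(1 / 2 : ℂ)‖ = 1 / 2 := by norm_num
  rw [integral_const_mul, abs_h] at integral_le
  rw [norm_smul, half_le, Real.rpow_neg_one, norm_inv, Real.norm_eq_abs, abs_abs]
  have := norm_nonneg (∫ w, Real.fourierChar (-inner ℝ w x) • (f w - f (w + h)))
  linarith

theorem fourier_of_hasDerivAt {f f' : ℝ → E} (hf : ∀ w, HasDerivAt f (f' w) w)
    (hf_int : Integrable f) (hf'_int : Integrable f') (x : ℝ) :
    𝓕 f' x = (2 * Real.pi * Complex.I * x : ℂ) • 𝓕 f x := by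
  have deriv_eq : deriv f = f' := funext fun w => (hf w).deriv
  rw [← deriv_eq] at hf'_int ⊢
  rw [Real.fourier_deriv hf_int (fun w => (hf w).differentiableAt) hf'_int]

theorem isBigO_fourier_of_hasDerivAt {f f' : ℝ → E} (hf : ∀ w, HasDerivAt f (f' w) w)
    (hf_int : Integrable f) (hf'_int : Integrable f') {s : ℝ}
    (hO : 𝓕 f' =O[cocompact ℝ] fun x => |x| ^ (s + 1)) :
    𝓕 f =O[cocompact ℝ] fun x => |x| ^ s := by
  have factor : (fun x : ℝ => (2 * Real.pi * Complex.I * x : ℂ)⁻¹) =O[cocompact ℝ]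
      fun x => |x| ^ (-1 : ℝ) :=
    .of_bound ‖(2 * Real.pi * Complex.I : ℂ)⁻¹‖ (.of_forall fun x => by
      simp [Real.rpow_neg_one, mul_comm])
  have ne_zero : ∀ᶠ x : ℝ in cocompact ℝ, x ≠ 0 := isCompact_singleton.compl_mem_cocompact
  refine (factor.smul hO).congr' ?_ ?_
  · filter_upwards [ne_zero] with x hx
    have : (2 * Real.pi * Complex.I * x : ℂ) ≠ 0 := by simp [hx, Real.pi_ne_zero]
    rw [fourier_of_hasDerivAt hf hf_int hf'_int, inv_smul_smul₀ this]
  · filter_upwards [ne_zero] with x hx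
    rw [smul_eq_mul, ← Real.rpow_add (abs_pos.2 hx), neg_add_cancel_comm_assoc]

end FourierDecay

/-! ### The cardinal sine -/

theorem analyticAt_dslope {𝕜 E : Type*} [NontriviallyNormedField 𝕜] [NormedAddCommGroup E]
    [NormedSpace 𝕜 E] {f : 𝕜 → E} {a b : 𝕜} (ha : AnalyticAt 𝕜 f a) (hb : AnalyticAt 𝕜 f b) :
    AnalyticAt 𝕜 (dslope f a) b := by
  rcases eq_or_ne b a with rfl | hba
  · obtain ⟨p, hp⟩ := hb
    exact hp.has_fpower_series_dslope_fslope.analyticAt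
  · refine AnalyticAt.congr ?_ (dslope_eventuallyEq_slope_of_ne f hba).symm
    exact ((analyticAt_id.sub analyticAt_const).inv (sub_ne_zero.2 hba)).smul
      (hb.sub analyticAt_const)

theorem contDiff_sinc {n : ℕ∞ω} : ContDiff ℝ n Real.sinc := by
  rw [Real.sinc_eq_dslope]
  exact AnalyticOnNhd.contDiff fun x _ =>
    analyticAt_dslope Real.analyticAt_sin Real.analyticAt_sin

theorem iteratedDeriv_succ_id_mul {𝕜 : Type*} [NontriviallyNormedField 𝕜] {f : 𝕜 → 𝕜} {k : ℕ}
    {w : 𝕜} (hf : ContDiffAt 𝕜 (k + 1 : ℕ) f w) :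
    iteratedDeriv (k + 1) (fun w => w * f w) w =
      w * iteratedDeriv (k + 1) f w + (k + 1) * iteratedDeriv k f w := by
  rw [iteratedDeriv_fun_mul (contDiffAt_fun_id (x := w)) hf, Finset.sum_range_succ',
    Finset.sum_range_succ']
  simp [iteratedDeriv_fun_id, add_comm]

theorem isBigO_decayWeight_of_mul {f : ℝ → ℝ} (hf : Continuous f)
    (hmul : (fun w => w * f w) =O[⊤] fun _ => (1 : ℝ)) : f =O[⊤] decayWeight := by
  obtain ⟨A, hA⟩ := (isCompact_Icc (a := (-1 : ℝ)) (b := 1)).exists_bound_of_continuousOn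
    hf.continuousOn
  obtain ⟨B, hB⟩ := hmul.bound
  refine .of_bound (2 * max A B) (.of_forall fun w => ?_)
  have product_le : |w| * |f w| ≤ B := by simpa using eventually_top.1 hB w
  have weight_le : |f w| * (1 + |w|) ≤ 2 * max A B := by
    rcases le_total |w| 1 with hw | hw
    · calc |f w| * (1 + |w|) ≤ A * (1 + 1) := by
            gcongr
            · exact (abs_nonneg _).trans (hA w (abs_le.1 hw))
            · exact hA w (abs_le.1 hw)
        _ ≤ 2 * max A B := by linarith [le_max_left A B]
    · have := le_mul_of_one_le_left (abs_nonneg (f w)) hw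
      linarith [le_max_right A B]
  rwa [Real.norm_of_nonneg (decayWeight_pos w).le, decayWeight, ← div_eq_mul_inv,
    le_div_iff₀ (by positivity)]

theorem isBigO_iteratedDeriv_decayWeight {f : ℝ → ℝ} (hf : ContDiff ℝ ∞ f)
    (hmul : ∀ k, iteratedDeriv k (fun w => w * f w) =O[⊤] fun _ => (1 : ℝ)) (k : ℕ) :
    iteratedDeriv k f =O[⊤] decayWeight := by
  induction k with
  | zero =>
    simp only [iteratedDeriv_zero] at hmul ⊢
    exact isBigO_decayWeight_of_mul hf.continuous (by simpa using hmul 0)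
  | succ k ih =>
    refine isBigO_decayWeight_of_mul (hf.continuous_iteratedDeriv _ (by exact_mod_cast le_top)) ?_
    have lower_order : (fun w => (k + 1) * iteratedDeriv k f w) =O[⊤] fun _ => (1 : ℝ) :=
      (ih.trans (.of_bound 1 (.of_forall fun w => by
        simpa [abs_of_nonneg (decayWeight_pos w).le] using decayWeight_le_one w))).const_mul_left _
    refine ((hmul (k + 1)).sub lower_order).congr_left fun w => ?_
    rw [iteratedDeriv_succ_id_mul (hf.contDiffAt.of_le (by exact_mod_cast le_top)),
      add_sub_cancel_right]

theorem abs_iteratedDeriv_sin_le_one (k : ℕ) (w : ℝ) : |iteratedDeriv k Real.sin w| ≤ 1 := by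
  obtain ⟨m, rfl | rfl⟩ := k.even_or_odd'
  · simpa [abs_mul] using Real.abs_sin_le_one w
  · simpa [abs_mul] using Real.abs_cos_le_one w

/-- The normalised cardinal sine `w ↦ sin (π w) / (π w)`, which has value `1` at the origin and
vanishes at every other integer. -/
noncomputable def normalizedSinc (w : ℝ) : ℝ := Real.sinc (Real.pi * w)

theorem contDiff_normalizedSinc {n : ℕ∞ω} : ContDiff ℝ n normalizedSinc :=
  contDiff_sinc.comp (contDiff_const.mul contDiff_id)

theorem mul_normalizedSinc (w : ℝ) :
    w * normalizedSinc w = Real.pi⁻¹ * Real.sin (Real.pi * w) := by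
  have := Real.pi_ne_zero
  rcases eq_or_ne w 0 with rfl | hw
  · simp
  · rw [normalizedSinc, Real.sinc_of_ne_zero (by positivity)]
    field_simp

theorem isBigO_iteratedDeriv_normalizedSinc (k : ℕ) :
    iteratedDeriv k normalizedSinc =O[⊤] decayWeight := by
  refine isBigO_iteratedDeriv_decayWeight contDiff_normalizedSinc (fun k => ?_) k
  refine .of_bound (Real.pi⁻¹ * Real.pi ^ k) (.of_forall fun w => ?_)
  rw [funext mul_normalizedSinc, iteratedDeriv_const_mul_field,
    iteratedDeriv_comp_const_mul Real.contDiff_sin, norm_one, norm_mul, norm_mul,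
    Real.norm_of_nonneg (by positivity), Real.norm_of_nonneg (by positivity), ← mul_assoc]
  exact mul_le_mul_of_nonneg_left (abs_iteratedDeriv_sin_le_one k _) (by positivity)

theorem normalizedSinc_zero : normalizedSinc 0 = 1 := by
  simp [normalizedSinc]

theorem normalizedSinc_neg (w : ℝ) : normalizedSinc (-w) = normalizedSinc w := by
  rw [normalizedSinc, mul_neg, Real.sinc_neg, normalizedSinc]

theorem normalizedSinc_intCast {n : ℤ} (hn : n ≠ 0) : normalizedSinc n = 0 := by
  have := mul_normalizedSinc n
  rw [mul_comm Real.pi, Real.sin_int_mul_pi, mul_zero] at this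
  exact (mul_eq_zero.1 this).resolve_left (Int.cast_ne_zero.2 hn)

/-! ### Cubes of decaying smooth functions -/

/-- Smooth functions on the line which are, together with all their derivatives, `O(1 / |w|)` at
infinity. For such `f` the Fourier transform of `|f| ^ 3` is `O(|x|⁻³)`. -/
structure HasDecayingDerivatives (f : ℝ → ℝ) : Prop where
  contDiff : ContDiff ℝ ∞ f
  isBigO_iteratedDeriv (k : ℕ) : iteratedDeriv k f =O[⊤] decayWeight

namespace HasDecayingDerivatives

variable {f : ℝ → ℝ}

theorem deriv (hf : HasDecayingDerivatives f) : HasDecayingDerivatives (deriv f) where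
  contDiff := (contDiff_infty_iff_deriv.1 hf.contDiff).2
  isBigO_iteratedDeriv k := by
    simpa only [← iteratedDeriv_succ'] using hf.isBigO_iteratedDeriv (k + 1)

theorem continuous (hf : HasDecayingDerivatives f) : Continuous f := hf.contDiff.continuous

theorem hasDerivAt (hf : HasDecayingDerivatives f) (w : ℝ) : HasDerivAt f (_root_.deriv f w) w :=
  ((contDiff_infty_iff_deriv.1 hf.contDiff).1 w).hasDerivAt

theorem isBigO (hf : HasDecayingDerivatives f) : f =O[⊤] decayWeight := by
  simpa using hf.isBigO_iteratedDeriv 0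

end HasDecayingDerivatives

theorem hasDerivAt_abs_mul_self (x : ℝ) : HasDerivAt (fun x : ℝ => |x| * x) (2 * |x|) x := by
  rcases eq_or_ne x 0 with rfl | hx
  · rw [hasDerivAt_iff_isLittleO]
    simpa using (isLittleO_one_iff ℝ).2 (by simpa using (continuous_abs.tendsto (0 : ℝ)))
      |>.mul_isBigO (isBigO_refl (fun x : ℝ => x) (𝓝 0))
  · refine ((hasDerivAt_abs hx).mul (hasDerivAt_id x)).congr_deriv ?_
    rw [id, mul_one, sign_mul_self, two_mul]

section AbsCube

variable {f : ℝ → ℝ}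

/-- The first derivative of `|f| ^ 3`. -/
noncomputable def absCubeDeriv (f : ℝ → ℝ) (w : ℝ) : ℝ := 3 * (|f w| * f w) * deriv f w

/-- The second derivative of `|f| ^ 3`. It need not be differentiable where `f` vanishes. -/
noncomputable def absCubeDerivTwo (f : ℝ → ℝ) (w : ℝ) : ℝ :=
  |f w| * (6 * deriv f w ^ 2 + 3 * f w * deriv (deriv f) w)

theorem hasDerivAt_abs_cube {w : ℝ} (hf : DifferentiableAt ℝ f w) :
    HasDerivAt (fun w => |f w| ^ 3) (absCubeDeriv f w) w := by
  have cube_eq : (fun w => |f w| ^ 3) = fun w => (|f w| * f w) * f w := by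
    funext w
    rw [mul_assoc, ← sq, ← sq_abs, pow_succ']
  rw [cube_eq]
  refine (((hasDerivAt_abs_mul_self (f w)).comp w hf.hasDerivAt).mul hf.hasDerivAt).congr_deriv ?_
  rw [absCubeDeriv, Function.comp_apply]
  ring

theorem hasDerivAt_absCubeDeriv {w : ℝ} (hf : DifferentiableAt ℝ f w)
    (hf' : DifferentiableAt ℝ (deriv f) w) :
    HasDerivAt (absCubeDeriv f) (absCubeDerivTwo f w) w := by
  refine ((((hasDerivAt_abs_mul_self (f w)).comp w hf.hasDerivAt).const_mul 3).mul
    hf'.hasDerivAt).congr_deriv ?_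
  rw [absCubeDerivTwo, Function.comp_apply]
  ring

end AbsCube

namespace HasDecayingDerivatives

variable {f : ℝ → ℝ}

theorem isBigO_abs_cube (hf : HasDecayingDerivatives f) :
    (fun w => |f w| ^ 3) =O[⊤] fun w => decayWeight w ^ 3 :=
  hf.isBigO.norm_left.pow 3

theorem isBigO_absCubeDeriv (hf : HasDecayingDerivatives f) :
    absCubeDeriv f =O[⊤] fun w => decayWeight w ^ 3 :=
  (((hf.isBigO.norm_left.mul hf.isBigO).const_mul_left 3).mul hf.deriv.isBigO).congr_right
    fun w => by ring

theorem isBigO_absCubeDerivTwo_factor (hf : HasDecayingDerivatives f) :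
    (fun w => 6 * _root_.deriv f w ^ 2 + 3 * f w * _root_.deriv (_root_.deriv f) w) =O[⊤]
      fun w => decayWeight w ^ 2 :=
  ((hf.deriv.isBigO.pow 2).const_mul_left 6).add
    (((hf.isBigO.const_mul_left 3).mul hf.deriv.deriv.isBigO).congr_right fun w => by ring)

theorem isBigO_absCubeDerivTwo (hf : HasDecayingDerivatives f) :
    absCubeDerivTwo f =O[⊤] fun w => decayWeight w ^ 3 :=
  (hf.isBigO.norm_left.mul hf.isBigO_absCubeDerivTwo_factor).congr_right fun w => by ring

theorem hasDecayingIncrements_absCubeDerivTwo (hf : HasDecayingDerivatives f) :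
    HasDecayingIncrements (absCubeDerivTwo f) 3 := by
  have factor_deriv (w : ℝ) := (((hf.deriv.hasDerivAt w).pow 2).const_mul 6).add
    (((hf.hasDerivAt w).const_mul 3).mul (hf.deriv.deriv.hasDerivAt w))
  have quadratic_term := (hf.deriv.isBigO.mul hf.deriv.deriv.isBigO).const_mul_left 15
  have third_order_term := (hf.isBigO.mul hf.deriv.deriv.deriv.isBigO).const_mul_left 3
  have factor := HasDecayingIncrements.of_hasDerivAt (n := 2) factor_deriv <|
    ((quadratic_term.add third_order_term).congr_left fun w => by ring).congr_right
      fun w => by ring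
  have norm := (HasDecayingIncrements.of_hasDerivAt (n := 1) hf.hasDerivAt
    (by simpa using hf.deriv.isBigO)).norm
  exact norm.mul factor (by simpa using hf.isBigO.norm_left) hf.isBigO_absCubeDerivTwo_factor

theorem integrable_abs_cube (hf : HasDecayingDerivatives f) :
    Integrable fun w => |f w| ^ 3 :=
  integrable_of_isBigO_decayWeight_pow (by norm_num) (hf.continuous.abs.pow 3) hf.isBigO_abs_cube

theorem continuous_absCubeDeriv (hf : HasDecayingDerivatives f) : Continuous (absCubeDeriv f) :=
  (continuous_const.mul (hf.continuous.abs.mul hf.continuous)).mul hf.deriv.continuous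

theorem integrable_absCubeDeriv (hf : HasDecayingDerivatives f) : Integrable (absCubeDeriv f) :=
  integrable_of_isBigO_decayWeight_pow (by norm_num) hf.continuous_absCubeDeriv
    hf.isBigO_absCubeDeriv

theorem integrable_absCubeDerivTwo (hf : HasDecayingDerivatives f) :
    Integrable (absCubeDerivTwo f) := by
  refine integrable_of_isBigO_decayWeight_pow (by norm_num) ?_ hf.isBigO_absCubeDerivTwo
  have := hf.continuous
  have := hf.deriv.continuous
  have := hf.deriv.deriv.continuous
  unfold absCubeDerivTwo
  fun_prop

theorem fourier_absCubeDeriv (hf : HasDecayingDerivatives f) (x : ℝ) :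
    𝓕 (fun w => (absCubeDeriv f w : ℂ)) x =
      2 * Real.pi * Complex.I * x * 𝓕 (fun w => ((|f w| ^ 3 : ℝ) : ℂ)) x :=
  fourier_of_hasDerivAt
    (fun w => (hasDerivAt_abs_cube (hf.hasDerivAt w).differentiableAt).ofReal_comp)
    hf.integrable_abs_cube.ofReal hf.integrable_absCubeDeriv.ofReal x

theorem isBigO_fourier_absCubeDeriv (hf : HasDecayingDerivatives f) :
    𝓕 (fun w => (absCubeDeriv f w : ℂ)) =O[cocompact ℝ] fun x => |x| ^ (-2 : ℝ) := by
  refine isBigO_fourier_of_hasDerivAt (fun w => (hasDerivAt_absCubeDeriv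
    (hf.hasDerivAt w).differentiableAt (hf.deriv.hasDerivAt w).differentiableAt).ofReal_comp)
    hf.integrable_absCubeDeriv.ofReal hf.integrable_absCubeDerivTwo.ofReal ?_
  norm_num only
  exact hf.hasDecayingIncrements_absCubeDerivTwo.ofReal.isBigO_fourier (by norm_num)
    hf.integrable_absCubeDerivTwo.ofReal

theorem isBigO_fourier_abs_cube (hf : HasDecayingDerivatives f) :
    𝓕 (fun w => ((|f w| ^ 3 : ℝ) : ℂ)) =O[cocompact ℝ] fun x => |x| ^ (-3 : ℝ) := by
  refine isBigO_fourier_of_hasDerivAt (fun w => (hasDerivAt_abs_cube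
    (hf.hasDerivAt w).differentiableAt).ofReal_comp)
    hf.integrable_abs_cube.ofReal hf.integrable_absCubeDeriv.ofReal ?_
  norm_num only
  exact hf.isBigO_fourier_absCubeDeriv

end HasDecayingDerivatives

/-! ### Poisson summation -/

theorem fourier_ofReal_of_even {g : ℝ → ℝ} (hg : Integrable g) (heven : ∀ w, g (-w) = g w)
    (x : ℝ) :
    𝓕 (fun w => (g w : ℂ)) x =
      ((2 * ∫ w in Ioi 0, Real.cos (2 * Real.pi * w * x) * g w : ℝ) : ℂ) := by
  let F (w : ℝ) : ℂ := Complex.exp ((-(2 * Real.pi * w * x) : ℝ) * Complex.I) * g w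
  have F_integrable : Integrable F := by
    refine hg.ofReal.bdd_mul (c := 1) (Continuous.aestronglyMeasurable (by fun_prop))
      (.of_forall fun w => ?_)
    rw [Complex.norm_exp_ofReal_mul_I]
  have fourier_eq : 𝓕 (fun w => (g w : ℂ)) x = ∫ w, F w := by
    rw [Real.fourier_eq']
    refine integral_congr_ae (.of_forall fun w => ?_)
    simp only [F, smul_eq_mul, RCLike.inner_apply, conj_trivial]
    ring_nf
  have symmetrize (w : ℝ) :
      F w + F (-w) = ((2 * (Real.cos (2 * Real.pi * w * x) * g w) : ℝ) : ℂ) := by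
    simp only [F, heven, mul_neg, neg_mul, neg_neg]
    push_cast
    rw [Complex.cos]
    ring
  have fold : ∫ w, Real.cos (2 * Real.pi * w * x) * g w =
      2 * ∫ w in Ioi 0, Real.cos (2 * Real.pi * w * x) * g w := by
    rw [← integral_comp_abs (f := fun w => Real.cos (2 * Real.pi * w * x) * g w)]
    refine integral_congr_ae (.of_forall fun w => ?_)
    rcases abs_choice w with h | h <;> simp only [h, heven, mul_neg, neg_mul, Real.cos_neg]
  have integral_symmetrize : ∫ w, (F w + F (-w)) = 2 * ∫ w, F w := by
    rw [integral_add F_integrable F_integrable.comp_neg, integral_neg_eq_self, two_mul]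
  simp only [symmetrize] at integral_symmetrize
  rw [integral_complex_ofReal, integral_const_mul, fold] at integral_symmetrize
  rw [fourier_eq, ← mul_right_inj' (two_ne_zero (α := ℂ)), ← integral_symmetrize]
  push_cast
  rfl

theorem hasDecayingDerivatives_normalizedSinc : HasDecayingDerivatives normalizedSinc where
  contDiff := contDiff_normalizedSinc
  isBigO_iteratedDeriv := isBigO_iteratedDeriv_normalizedSinc

theorem ofReal_quasiLagrange (x : ℝ) :
    (quasiLagrange x : ℂ) = 𝓕 (fun w => ((|normalizedSinc w| ^ 3 : ℝ) : ℂ)) x := by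
  have rescale := integral_comp_mul_left_Ioi
    (fun ξ => Real.cos (ξ * x) * oddSymbol ξ / ξ ^ 3) 0 Real.two_pi_pos
  have integrand_eq : EqOn
      (fun w => Real.cos (2 * Real.pi * w * x) * oddSymbol (2 * Real.pi * w) /
        (2 * Real.pi * w) ^ 3)
      (fun w => Real.cos (2 * Real.pi * w * x) * |normalizedSinc w| ^ 3) (Ioi 0) := fun w hw => by
    have pos : 0 < 2 * Real.pi * w := mul_pos Real.two_pi_pos hw
    dsimp only
    rw [oddSymbol_eq_abs_mul_sinc, mul_assoc 2, mul_div_cancel_left₀ _ two_ne_zero, ← mul_assoc,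
      abs_mul, abs_of_pos pos, mul_pow, normalizedSinc,
      mul_left_comm, mul_div_cancel_left₀ _ (pow_pos pos 3).ne']
  rw [setIntegral_congr_fun measurableSet_Ioi integrand_eq, mul_zero, smul_eq_mul,
    inv_mul_eq_div, eq_div_iff Real.two_pi_pos.ne'] at rescale
  rw [fourier_ofReal_of_even hasDecayingDerivatives_normalizedSinc.integrable_abs_cube
    (fun w => by rw [normalizedSinc_neg]), quasiLagrange_eq_integral, ← rescale]
  rw [mul_comm _ (2 * Real.pi), ← mul_assoc, mul_left_comm, inv_mul_cancel₀ Real.pi_ne_zero,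
    mul_one]

theorem continuous_fourier_of_integrable {E : Type*} [NormedAddCommGroup E] [NormedSpace ℂ E]
    {g : ℝ → E} (hg : Integrable g) : Continuous (𝓕 g) :=
  VectorFourier.fourierIntegral_continuous Real.continuous_fourierChar
    (innerSL ℝ).continuous₂ hg

theorem integrable_of_isBigO_abs_rpow {E : Type*} [NormedAddCommGroup E] {f : ℝ → E}
    (hf : Continuous f) {b : ℝ} (hb : 1 < b) (hO : f =O[cocompact ℝ] fun x => |x| ^ (-b)) :
    Integrable f := by
  have decay : (fun x : ℝ => |x| ^ (-b)) =O[cocompact ℝ] fun x => (1 + ‖x‖) ^ (-b) := by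
    refine .of_bound (2 ^ b) ?_
    filter_upwards [tendsto_norm_cocompact_atTop.eventually_ge_atTop 1] with x hx
    rw [Real.norm_eq_abs] at hx
    have abs_pos : 0 < |x| := one_pos.trans_le hx
    have one_add_pos : 0 < 1 + |x| := by positivity
    simp only [Real.norm_eq_abs, Real.abs_rpow_of_nonneg abs_pos.le,
      Real.abs_rpow_of_nonneg one_add_pos.le, abs_abs, abs_of_pos one_add_pos]
    calc |x| ^ (-b) ≤ ((1 + |x|) / 2) ^ (-b) :=
          Real.rpow_le_rpow_of_nonpos (by positivity) (by linarith) (by linarith)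
      _ = 2 ^ b * (1 + |x|) ^ (-b) := by
          rw [Real.div_rpow one_add_pos.le zero_le_two, Real.rpow_neg zero_le_two, div_inv_eq_mul,
            mul_comm]
  exact hf.locallyIntegrable.integrable_of_isBigO_cocompact (hO.trans decay)
    ((integrable_one_add_norm (by simpa using hb)).integrableAtFilter _)

theorem summable_comp_sub_intCast {E : Type*} [NormedAddCommGroup E] [CompleteSpace E] {f : ℝ → E}
    {b : ℝ} (hb : 1 < b) (hO : f =O[cocompact ℝ] fun x => |x| ^ (-b)) (x : ℝ) :
    Summable fun k : ℤ => f (x - k) := by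
  have shift_tendsto : Tendsto (fun k : ℤ => x - k) cofinite (cocompact ℝ) :=
    (Homeomorph.subLeft x).isClosedEmbedding.tendsto_cocompact.comp Int.tendsto_coe_cofinite
  refine summable_of_isBigO (((Real.summable_one_div_int_add_rpow (-x) b).2 hb).congr fun k => ?_)
    (hO.comp_tendsto shift_tendsto)
  rw [Function.comp_apply, Real.rpow_neg (abs_nonneg _), one_div, ← sub_eq_add_neg, abs_sub_comm]

theorem hasSum_fourier_sub_intCast {g : ℝ → ℂ} (hg : Continuous g) (hg_int : Integrable g)
    {b : ℝ} (hb : 1 < b) (hO : 𝓕 g =O[cocompact ℝ] fun x => |x| ^ (-b))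
    (hzero : ∀ n : ℤ, n ≠ 0 → g n = 0) (x : ℝ) :
    HasSum (fun k : ℤ => 𝓕 g (x - k)) (g 0) := by
  have fourier_continuous := continuous_fourier_of_integrable hg_int
  have fourier_fourier (n : ℤ) : 𝓕 (𝓕 g) n = g (-n) := by
    rw [← neg_neg (n : ℝ), ← Real.fourierInv_eq_fourier_neg, hg.fourierInv_fourier_eq hg_int
      (integrable_of_isBigO_abs_rpow fourier_continuous hb hO), neg_neg]
  have fourier_fourier_eq_zero (n : ℤ) (hn : n ≠ 0) : 𝓕 (𝓕 g) n = 0 := by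
    rw [fourier_fourier, ← Int.cast_neg, hzero _ (neg_ne_zero.2 hn)]
  have poisson := Real.tsum_eq_tsum_fourier_of_rpow_decay_of_summable fourier_continuous hb hO
    (summable_of_ne_finset_zero (s := {0}) fun n hn =>
      fourier_fourier_eq_zero n (Finset.notMem_singleton.1 hn)) x
  have dual_sum : ∑' n : ℤ, 𝓕 (𝓕 g) n * fourier n (x : UnitAddCircle) = g 0 := by
    rw [tsum_eq_single 0 fun n hn => by rw [fourier_fourier_eq_zero n hn, zero_mul],
      fourier_fourier, fourier_zero, mul_one, Int.cast_zero, neg_zero]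
  rw [dual_sum, ← (Equiv.neg ℤ).tsum_eq] at poisson
  simp only [Equiv.neg_apply, Int.cast_neg, ← sub_eq_add_neg] at poisson
  exact poisson ▸ (summable_comp_sub_intCast hb hO x).hasSum

theorem absCubeDeriv_normalizedSinc_intCast (n : ℤ) : absCubeDeriv normalizedSinc n = 0 := by
  rcases eq_or_ne n 0 with rfl | hn
  · have deriv_zero : deriv normalizedSinc 0 = 0 := by
      rw [← self_eq_neg]
      simpa only [normalizedSinc_neg, neg_zero] using deriv_comp_neg normalizedSinc 0
    rw [absCubeDeriv, Int.cast_zero, deriv_zero, mul_zero]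
  · rw [absCubeDeriv, normalizedSinc_intCast hn, mul_zero, mul_zero, zero_mul]

theorem hasSum_quasiLagrange_sub_intCast (x : ℝ) :
    HasSum (fun k : ℤ => quasiLagrange (x - k)) 1 := by
  have decaying := hasDecayingDerivatives_normalizedSinc
  rw [← Complex.hasSum_ofReal]
  simp only [ofReal_quasiLagrange]
  convert hasSum_fourier_sub_intCast (g := fun w => ((|normalizedSinc w| ^ 3 : ℝ) : ℂ))
    (Complex.continuous_ofReal.comp (decaying.continuous.abs.pow 3))
    decaying.integrable_abs_cube.ofReal (by norm_num : (1 : ℝ) < 3)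
    decaying.isBigO_fourier_abs_cube (fun n hn => ?_) x using 1
  · rw [normalizedSinc_zero, abs_one, one_pow]
  · rw [normalizedSinc_intCast hn, abs_zero, zero_pow three_ne_zero, Complex.ofReal_zero]

theorem hasSum_sub_intCast_mul_quasiLagrange (x : ℝ) :
    HasSum (fun k : ℤ => (x - k) * quasiLagrange (x - k)) 0 := by
  have decaying := hasDecayingDerivatives_normalizedSinc
  have at_zero : absCubeDeriv normalizedSinc 0 = 0 := by
    simpa only [Int.cast_zero] using absCubeDeriv_normalizedSinc_intCast 0
  have scaled_sum := hasSum_fourier_sub_intCast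
    (g := fun w => (absCubeDeriv normalizedSinc w : ℂ))
    (Complex.continuous_ofReal.comp decaying.continuous_absCubeDeriv)
    decaying.integrable_absCubeDeriv.ofReal one_lt_two decaying.isBigO_fourier_absCubeDeriv
    (fun n _ => congrArg Complex.ofReal (absCubeDeriv_normalizedSinc_intCast n)) x
  simp only [decaying.fourier_absCubeDeriv, ← ofReal_quasiLagrange,
    mul_assoc (2 * (Real.pi : ℂ) * Complex.I), ← Complex.ofReal_mul, at_zero,
    Complex.ofReal_zero] at scaled_sum
  rwa [← Complex.hasSum_ofReal, ← hasSum_mul_left_iff Complex.two_pi_I_ne_zero, Complex.ofReal_zero,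
    mul_zero]

theorem hasSum_affine_mul_quasiLagrange (a b x : ℝ) :
    HasSum (fun k : ℤ => (a * k + b) * quasiLagrange (x - k)) (a * x + b) := by
  convert! ((hasSum_quasiLagrange_sub_intCast x).mul_left (a * x + b)).sub
    ((hasSum_sub_intCast_mul_quasiLagrange x).mul_left a) using 1
  · ext k
    ring
  · rw [mul_one, mul_zero, sub_zero]

theorem mainTheorem3 :
    (∀ x : ℝ, Summable fun j : ℤ => lam j * thinPlateSpline |x - j|) ∧
    ∀ p : ℝ[X], p.degree ≤ 1 → ∀ x : ℝ,
      HasSum (fun k : ℤ => p.eval (k : ℝ) * quasiLagrange (x - k)) (p.eval x) := by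
  refine ⟨fun x => (hasSum_lam_mul_thinPlateSpline x).summable, fun p hp x => ?_⟩
  rw [eq_X_add_C_of_degree_le_one hp]
  simpa only [eval_add, eval_mul, eval_C, eval_X] using
    hasSum_affine_mul_quasiLagrange (p.coeff 1) (p.coeff 0) x
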